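/- Let $a,b\ge 1$ be integers and write $\Sigma_{a,b}=\{0,\dots,a\}\times\{0,\dots,b\}$. **Nets.** A map $P\colon\Sigma_{a,b}\to\mathbb{RP}^n$ is a *Q-net* if for every $0\le i<a$, $0\le j<b$ the points $P(i,j),P(i+1,j),P(i,j+1),P(i+1,j+1)$ of the face $(i,j)$ lie in a plane. It is *non-degenerate* if the two points of each edge are distinct and any three of the four points of each face span a plane. It is *extensive* if it is non-degenerate and its points join a projective space of dimension $a+b$. **Quadrics.** A *quadric* in a real projective space is the zero set $\{[x] : \varphi(x,x)=0\}$ of a non-trivial symmetric bilinear form $\varphi$; a *conic* is a quadric in a projective plane. Two points $[x],[y]$ are *conjugate* relative to the quadric if $\varphi(x,y)=0$. A projective subspace $A$ is *tangent* to a quadric $\mathcal Q$ *along* a subspace $B$ if $B\subseteq A$, $B\subseteq\mathcal Q$, and every point of $A$ is conjugate to every point of $B$ relative to $\mathcal Q$, for every bilinear form $\varphi$ that defines $\mathcal Q$. **Touching conics.** An *inscribed conic* of a face is a conic in the plane of the face that touches each of its four edge lines (meets it in exactly one point, hence with multiplicity two), where a double line is admitted only if it is the line joining the two intersection points of opposite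 edge lines of the face. An *instance of touching conics* $\mathcal C$ of a non-degenerate Q-net assigns to each face $(i,j)$ an inscribed conic $\mathcal C(i,j)$ such that, whenever two faces share an edge, their conics touch the line of this edge in the same point. A non-degenerate Q-net is a *Kœnigs net* if it admits an instance of touching conics. For $0\le i<a$, $0\le j\le b$ let $S(i,j)$ be the point in which the conics of the faces adjacent to the edge $P(i,j)P(i+1,j)$ touch the line of this edge; for $0\le i\le a$, $0\le j<b$ let $T(i,j)$ be the point in which the conics of the faces adjacent to the edge $P(i,j)P(i,j+1)$ touch the line of this edge. Define the joins $$P^{v}(i)=\bigvee_{j=0}^{b}P(i,j),\quad P^{h}(j)=\bigvee_{i=0}^{a}P(i,j),\quad T^{v}(i)=\bigvee_{j=0}^{b-1}T(i,j),\quad S^{h}(j)=\bigvee_{i=0}^{a-1}S(i,j).$$ **Inscribed quadrics.** Let $P\colon\Sigma_{a,b}\to\mathbb{RP}^{a+b}$ be an extensive Kœnigs net with an instance of touching conics $\mathcal C$. A quadric $\mathcal Q\subset\mathbb{RP}^{a+b}$ is an *inscribed quadric* with respect to $\mathcal C$ if $\mathcal C(i,j)=\mathcal Q\cap\bigl(P(i,j)\vee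 P(i+1,j)\vee P(i,j+1)\bigr)$ for all $0\le i<a$, $0\le j<b$, and $T^{v}(i)\subseteq\mathcal Q$ for all $0\le i\le a$, and $S^{h}(j)\subseteq\mathcal Q$ for all $0\le j\le b$. **Lemma.** Let $P\colon\Sigma_{a,b}\to\mathbb{RP}^{a+b}$ be an extensive Kœnigs net with an inscribed quadric $\mathcal Q$ with respect to touching conics $\mathcal C$. Then 1. for all $0\le i\le a$, $P^{v}(i)$ is tangent to $\mathcal Q$ along $T^{v}(i)$; 2. for all $0\le j\le b$, $P^{h}(j)$ is tangent to $\mathcal Q$ along $S^{h}(j)$. -/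

import Mathlib

noncomputable section

namespace Koenigs

/-- Real projective space `ℝPⁿ`. -/
abbrev RP (n : ℕ) : Type := Projectivization ℝ (Fin (n + 1) → ℝ)

/-- A `d`-dimensional projective subspace of `ℝPⁿ` is represented by the `(d+1)`-dimensional linear
subspace of `ℝⁿ⁺¹` of which it is the projectivization; the join of projective subspaces is then
the supremum, and their intersection the infimum, of linear subspaces. -/
abbrev Space (n : ℕ) : Type := Submodule ℝ (Fin (n + 1) → ℝ)

/-- The set of points of a projective subspace. -/
def pts {n : ℕ} (A : Space n) : Set (RP n) := {X | X.submodule ≤ A}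

/-- The line joining two (distinct) points. -/
def line {n : ℕ} (X Y : RP n) : Space n := X.submodule ⊔ Y.submodule

/-- The plane joining three (non-collinear) points. -/
def plane {n : ℕ} (X Y Z : RP n) : Space n := X.submodule ⊔ Y.submodule ⊔ Z.submodule

/-! ### Quadrics and conics -/

/-- The set `{[x] | φ(x, x) = 0}`. -/
def zeroSet {n : ℕ} (φ : LinearMap.BilinForm ℝ (Fin (n + 1) → ℝ)) : Set (RP n) :=
  {X | φ X.rep X.rep = 0}

/-- `φ` is a non-trivial symmetric bilinear form whose associated quadric is `Q`. -/
def Represents {n : ℕ} (φ : LinearMap.BilinForm ℝ (Fin (n + 1) → ℝ)) (Q : Set (RP n)) : Prop :=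
  φ.IsSymm ∧ φ ≠ 0 ∧ Q = zeroSet φ

/-- `Q` is a quadric in `ℝPⁿ`. -/
def IsQuadric {n : ℕ} (Q : Set (RP n)) : Prop := ∃ φ, Represents φ Q

/-- Every point of `A` is conjugate to every point of `B` relative to the quadric `Q`, whichever
bilinear form is chosen to represent `Q`. -/
def AreConjugate {n : ℕ} (Q : Set (RP n)) (A B : Space n) : Prop :=
  ∀ φ, Represents φ Q → ∀ x ∈ A, ∀ y ∈ B, φ x y = 0

/-- The projective subspace `A` is tangent to the quadric `Q` along the projective subspace `B`:
`B` is contained in `A` and in `Q`, and `A` is conjugate to `B`, that is, `A` lies in the polar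
of every point of `B`. -/
def IsTangentAlong {n : ℕ} (Q : Set (RP n)) (A B : Space n) : Prop :=
  IsQuadric Q ∧ B ≤ A ∧ pts B ⊆ Q ∧ AreConjugate Q A B

/-- `C` is a conic in the plane `E`, that is, the zero set in `E` of a symmetric bilinear form that
is non-trivial on `E`.  (Every symmetric bilinear form on `E` is the restriction of one on the
ambient space.) -/
def IsConicIn {n : ℕ} (E : Space n) (C : Set (RP n)) : Prop :=
  ∃ φ : LinearMap.BilinForm ℝ (Fin (n + 1) → ℝ),
    φ.IsSymm ∧ φ.restrict E ≠ 0 ∧ C = zeroSet φ ∩ pts E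

/-- The line `L` touches the conic `C` in the point `X`, and in no other point: a line of the plane
of a conic that meets the conic in exactly one point meets it there with multiplicity two, since
a real binary quadratic form with exactly one zero on the projective line has a double zero. -/
def TouchesAt {n : ℕ} (C : Set (RP n)) (L : Space n) (X : RP n) : Prop :=
  C ∩ pts L = {X}

/-! ### Nets -/

/-- A net: a map from `Σ_{a,b} = {0, …, a} × {0, …, b}` to `ℝPⁿ`. -/
abbrev Net (n a b : ℕ) : Type := Fin (a + 1) → Fin (b + 1) → RP n

/-- A Q-net: the image of each face is contained in a plane. -/
def IsQNet {n a b : ℕ} (P : Net n a b) : Prop :=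
  ∀ (i : Fin a) (j : Fin b), ∃ E : Space n, Module.finrank ℝ E = 3 ∧
    P i.castSucc j.castSucc ∈ pts E ∧ P i.succ j.castSucc ∈ pts E ∧
    P i.castSucc j.succ ∈ pts E ∧ P i.succ j.succ ∈ pts E

/-- A non-degenerate Q-net: the two points of each edge are distinct, and any three of the four
points of each face span a plane. -/
structure IsNondegenerate {n a b : ℕ} (P : Net n a b) : Prop where
  qnet : IsQNet P
  edge_h : ∀ (i : Fin a) (j : Fin (b + 1)), P i.castSucc j ≠ P i.succ j
  edge_v : ∀ (i : Fin (a + 1)) (j : Fin b), P i j.castSucc ≠ P i j.succ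
  face : ∀ (i : Fin a) (j : Fin b),
    Module.finrank ℝ (plane (P i.castSucc j.castSucc) (P i.succ j.castSucc)
      (P i.castSucc j.succ)) = 3 ∧
    Module.finrank ℝ (plane (P i.castSucc j.castSucc) (P i.succ j.castSucc)
      (P i.succ j.succ)) = 3 ∧
    Module.finrank ℝ (plane (P i.castSucc j.castSucc) (P i.castSucc j.succ)
      (P i.succ j.succ)) = 3 ∧
    Module.finrank ℝ (plane (P i.succ j.castSucc) (P i.castSucc j.succ)
      (P i.succ j.succ)) = 3

/-- An extensive Q-net: it is non-degenerate and its points join a space of (projective)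
dimension `a + b`. -/
def IsExtensive {n a b : ℕ} (P : Net n a b) : Prop :=
  IsNondegenerate P ∧
    Module.finrank ℝ (⨆ i : Fin (a + 1), ⨆ j : Fin (b + 1), (P i j).submodule : Space n)
      = a + b + 1

/-! ### Touching conics and Kœnigs nets -/

/-- The join of the two Laplace points
`(P₀₀ ∨ P₀₁) ∩ (P₁₀ ∨ P₁₁)` and `(P₀₀ ∨ P₁₀) ∩ (P₀₁ ∨ P₁₁)` of a quad. -/
def laplaceLine {n : ℕ} (P₀₀ P₁₀ P₀₁ P₁₁ : RP n) : Space n :=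
  (line P₀₀ P₀₁ ⊓ line P₁₀ P₁₁) ⊔ (line P₀₀ P₁₀ ⊓ line P₀₁ P₁₁)

/-- `C` is an inscribed conic of the planar quad with the edges `P₀₀P₁₀`, `P₁₀P₁₁`, `P₀₁P₁₁`,
`P₀₀P₀₁`: a conic in the plane of the quad that touches the four edge lines, where a (double) line
is only admitted if it is the line through the two Laplace points of the quad. -/
structure IsInscribedConic {n : ℕ} (P₀₀ P₁₀ P₀₁ P₁₁ : RP n) (C : Set (RP n)) : Prop where
  conic : IsConicIn (plane P₀₀ P₁₀ P₀₁) C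
  south : ∃ X, TouchesAt C (line P₀₀ P₁₀) X
  north : ∃ X, TouchesAt C (line P₀₁ P₁₁) X
  west : ∃ X, TouchesAt C (line P₀₀ P₀₁) X
  east : ∃ X, TouchesAt C (line P₁₀ P₁₁) X
  double_line : ∀ ℓ : Space n, Module.finrank ℝ ℓ = 2 → C = pts ℓ →
    ℓ = laplaceLine P₀₀ P₁₀ P₀₁ P₁₁

/-- An instance of touching conics of a net: every quad is equipped with an inscribed conic such
that, for every edge, the conics of the (one or two) adjacent quads touch the line of the edge in
the same point. -/
structure TouchingConics {n a b : ℕ} (P : Net n a b) where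
  /-- `conic i j` is the conic of the quad `P(i,j)`, `P(i+1,j)`, `P(i,j+1)`, `P(i+1,j+1)`. -/
  conic : Fin a → Fin b → Set (RP n)
  inscribed : ∀ i j, IsInscribedConic (P i.castSucc j.castSucc) (P i.succ j.castSucc)
    (P i.castSucc j.succ) (P i.succ j.succ) (conic i j)
  touch_h : ∀ (i : Fin a) (j : Fin (b + 1)), ∃ X : RP n,
    ∀ k : Fin b, (k.castSucc = j ∨ k.succ = j) →
      TouchesAt (conic i k) (line (P i.castSucc j) (P i.succ j)) X
  touch_v : ∀ (i : Fin (a + 1)) (j : Fin b), ∃ X : RP n,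
    ∀ k : Fin a, (k.castSucc = i ∨ k.succ = i) →
      TouchesAt (conic k j) (line (P i j.castSucc) (P i j.succ)) X

/-- A Kœnigs net: a non-degenerate Q-net that admits an instance of touching conics. -/
def IsKoenigsNet {n a b : ℕ} (P : Net n a b) : Prop :=
  IsNondegenerate P ∧ Nonempty (TouchingConics P)

namespace TouchingConics

variable {n a b : ℕ} {P : Net n a b}

/-- `S(i,j)` is the point in which the conics of the quads adjacent to the edge
`P(i,j)`, `P(i+1,j)` touch the line of this edge (unique as soon as there is an adjacent quad,
see `eq_S`). -/
def S (c : TouchingConics P) (i : Fin a) (j : Fin (b + 1)) : RP n := (c.touch_h i j).choose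

/-- `T(i,j)` is the point in which the conics of the quads adjacent to the edge
`P(i,j)`, `P(i,j+1)` touch the line of this edge (unique as soon as there is an adjacent quad,
see `eq_T`). -/
def T (c : TouchingConics P) (i : Fin (a + 1)) (j : Fin b) : RP n := (c.touch_v i j).choose

theorem touchesAt_S (c : TouchingConics P) (i : Fin a) (j : Fin (b + 1)) (k : Fin b)
    (hk : k.castSucc = j ∨ k.succ = j) :
    TouchesAt (c.conic i k) (line (P i.castSucc j) (P i.succ j)) (c.S i j) :=
  (c.touch_h i j).choose_spec k hk

theorem touchesAt_T (c : TouchingConics P) (i : Fin (a + 1)) (j : Fin b) (k : Fin a)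
    (hk : k.castSucc = i ∨ k.succ = i) :
    TouchesAt (c.conic k j) (line (P i j.castSucc) (P i j.succ)) (c.T i j) :=
  (c.touch_v i j).choose_spec k hk

theorem eq_S (c : TouchingConics P) (i : Fin a) (j : Fin (b + 1)) (k : Fin b)
    (hk : k.castSucc = j ∨ k.succ = j) (X : RP n)
    (hX : TouchesAt (c.conic i k) (line (P i.castSucc j) (P i.succ j)) X) : X = c.S i j :=
  Set.singleton_injective (hX.symm.trans (c.touchesAt_S i j k hk))

theorem eq_T (c : TouchingConics P) (i : Fin (a + 1)) (j : Fin b) (k : Fin a)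
    (hk : k.castSucc = i ∨ k.succ = i) (X : RP n)
    (hX : TouchesAt (c.conic k j) (line (P i j.castSucc) (P i j.succ)) X) : X = c.T i j :=
  Set.singleton_injective (hX.symm.trans (c.touchesAt_T i j k hk))

/-- The horizontal space of the net `S` at `j`, the join of the points `S(i,j)` over all `i`. -/
def spaceS (c : TouchingConics P) (j : Fin (b + 1)) : Space n :=
  ⨆ i : Fin a, (c.S i j).submodule

/-- The vertical space of the net `T` at `i`, the join of the points `T(i,j)` over all `j`. -/
def spaceT (c : TouchingConics P) (i : Fin (a + 1)) : Space n :=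
  ⨆ j : Fin b, (c.T i j).submodule

end TouchingConics

/-- The horizontal parameter space of `P` at `j`, the join of the points `P(i,j)` over all `i`. -/
def horizontalSpace {n a b : ℕ} (P : Net n a b) (j : Fin (b + 1)) : Space n :=
  ⨆ i : Fin (a + 1), (P i j).submodule

/-- The vertical parameter space of `P` at `i`, the join of the points `P(i,j)` over all `j`. -/
def verticalSpace {n a b : ℕ} (P : Net n a b) (i : Fin (a + 1)) : Space n :=
  ⨆ j : Fin (b + 1), (P i j).submodule

/-- `Q` is an inscribed quadric of the net `P` with respect to the touching conics `c`. -/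
structure IsInscribedQuadric {n a b : ℕ} {P : Net n a b} (c : TouchingConics P)
    (Q : Set (RP n)) : Prop where
  quadric : IsQuadric Q
  conic_eq : ∀ (i : Fin a) (j : Fin b), c.conic i j =
    Q ∩ pts (plane (P i.castSucc j.castSucc) (P i.succ j.castSucc) (P i.castSucc j.succ))
  spaceT_subset : ∀ i : Fin (a + 1), pts (c.spaceT i) ⊆ Q
  spaceS_subset : ∀ j : Fin (b + 1), pts (c.spaceS j) ⊆ Q

end Koenigs

end

namespace Koenigs

open Module

variable {n : ℕ}

/-! Fix a column i. The subspace spanned by the points T(i,j) lies in the quadric, so by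
polarization any two of these points are conjugate. The edge line through P(i,j) and P(i,j+1)
touches the quadric at T(i,j), so it lies in the polar of T(i,j). If this polar contains P(i,k) or
P(i,k+1), then it contains the other one too: it also contains T(i,k), and the edge line is spanned
by T(i,k) and either endpoint. Hence the polar of T(i,j) contains the whole column
(`conjugate_of_touching_chain`). Rows are treated alike.

The propagation needs T(i,k) to differ from both endpoints of its edge (`not_touchesAt_vertex`). A
conic touching an edge line at a vertex is singular there, and the remaining edges force it to be a
double line. The condition on double lines then puts that vertex on the opposite edge line, against
non-degeneracy. -/

theorem rep_mem_submodule (X : RP n) : X.rep ∈ X.submodule := by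
  rw [Projectivization.submodule_eq]; exact Submodule.mem_span_singleton_self _

theorem submodule_le_iff_rep_mem {X : RP n} {A : Space n} : X.submodule ≤ A ↔ X.rep ∈ A := by
  rw [Projectivization.submodule_eq, Submodule.span_singleton_le_iff_mem]

theorem submodule_le_iff_mem {X : RP n} {A : Space n} {v : Fin (n + 1) → ℝ}
    (hv : v ∈ X.submodule) (h0 : v ≠ 0) : X.submodule ≤ A ↔ v ∈ A := by
  refine ⟨fun h => h hv, fun h => ?_⟩
  rw [Projectivization.submodule_eq, Submodule.mem_span_singleton] at hv
  obtain ⟨r, rfl⟩ := hv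
  have hr : r ≠ 0 := by rintro rfl; simp at h0
  rw [submodule_le_iff_rep_mem]
  exact (Submodule.smul_mem_iff _ hr).1 h

theorem eq_of_submodule_le {X Y : RP n} (h : X.submodule ≤ Y.submodule) : X = Y := by
  apply Projectivization.submodule_injective
  apply Submodule.eq_of_le_of_finrank_eq h
  rw [Projectivization.finrank_submodule, Projectivization.finrank_submodule]

theorem mem_zeroSet_iff {φ : LinearMap.BilinForm ℝ (Fin (n + 1) → ℝ)} {X : RP n} :
    X ∈ zeroSet φ ↔ ∀ v ∈ X.submodule, φ v v = 0 := by
  refine ⟨fun h v hv => ?_, fun h => h _ (rep_mem_submodule X)⟩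
  rw [Projectivization.submodule_eq, Submodule.mem_span_singleton] at hv
  obtain ⟨r, rfl⟩ := hv
  have h' : φ X.rep X.rep = 0 := h
  simp [h']

theorem mk_mem_zeroSet {φ : LinearMap.BilinForm ℝ (Fin (n + 1) → ℝ)} {v : Fin (n + 1) → ℝ}
    (h0 : v ≠ 0) (h : φ v v = 0) : Projectivization.mk ℝ v h0 ∈ zeroSet φ := by
  rw [mem_zeroSet_iff, Projectivization.submodule_mk]
  intro w hw
  obtain ⟨r, rfl⟩ := Submodule.mem_span_singleton.1 hw
  simp [h]

/-! ### Lines and planes -/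

theorem left_le_line (X Y : RP n) : X.submodule ≤ line X Y := le_sup_left

theorem right_le_line (X Y : RP n) : Y.submodule ≤ line X Y := le_sup_right

theorem line_comm (X Y : RP n) : line X Y = line Y X := sup_comm _ _

theorem plane_rotate (X Y Z : RP n) : plane X Y Z = plane Y Z X := by
  unfold plane; rw [sup_assoc, sup_comm]

theorem plane_swap (X Y Z : RP n) : plane X Y Z = plane Y X Z := by
  unfold plane; rw [sup_comm X.submodule]

theorem plane_eq_of_le {E : Space n} (hE : finrank ℝ E = 3) {X Y Z : RP n}
    (h : finrank ℝ (plane X Y Z) = 3) (hX : X.submodule ≤ E) (hY : Y.submodule ≤ E)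
    (hZ : Z.submodule ≤ E) : plane X Y Z = E :=
  Submodule.eq_of_le_of_finrank_eq (sup_le (sup_le hX hY) hZ) (h.trans hE.symm)

theorem finrank_line_le (X Y : RP n) : finrank ℝ (line X Y) ≤ 2 := by
  have := Submodule.finrank_add_le_finrank_add_finrank X.submodule Y.submodule
  rw [Projectivization.finrank_submodule, Projectivization.finrank_submodule] at this
  exact this

theorem finrank_line_of_finrank_plane {X Y Z : RP n} (h : finrank ℝ (plane X Y Z) = 3) :
    finrank ℝ (line X Y) = 2 := by
  have h1 := Submodule.finrank_add_le_finrank_add_finrank (line X Y) Z.submodule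
  have h2 := finrank_line_le X Y
  have h3 : finrank ℝ (line X Y ⊔ Z.submodule : Space n) = 3 := h
  rw [Projectivization.finrank_submodule] at h1
  omega

theorem not_le_line_of_finrank_plane {X Y Z : RP n} (h : finrank ℝ (plane X Y Z) = 3) :
    ¬ Z.submodule ≤ line X Y := by
  intro hZ
  have h3 : finrank ℝ (line X Y ⊔ Z.submodule : Space n) = 3 := h
  rw [sup_eq_left.2 hZ] at h3
  have := finrank_line_le X Y
  omega

theorem finrank_line_of_ne {X Y : RP n} (h : X ≠ Y) : finrank ℝ (line X Y) = 2 := by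
  have h1 : X.submodule < line X Y := by
    refine lt_of_le_of_ne (left_le_line X Y) fun he => h (eq_of_submodule_le ?_).symm
    rw [he]; exact right_le_line X Y
  have h2 := Submodule.finrank_lt_finrank_of_lt h1
  rw [Projectivization.finrank_submodule] at h2
  have := finrank_line_le X Y
  omega

theorem finrank_plane_of_not_le {X Y Z : RP n} (h : finrank ℝ (line X Y) = 2)
    (hZ : ¬ Z.submodule ≤ line X Y) : finrank ℝ (plane X Y Z) = 3 := by
  have h1 : line X Y < plane X Y Z := by
    refine lt_of_le_of_ne le_sup_left fun he => hZ ?_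
    rw [he]; exact le_sup_right
  have h2 := Submodule.finrank_lt_finrank_of_lt h1
  have h3 := Submodule.finrank_add_le_finrank_add_finrank (line X Y) Z.submodule
  have h4 : finrank ℝ (plane X Y Z) ≤ finrank ℝ (line X Y) + finrank ℝ Z.submodule := h3
  rw [Projectivization.finrank_submodule] at h4
  omega

/-- Two lines in a plane have a common point. -/
theorem exists_ne_zero_mem_inf {E L M : Space n} (hE : finrank ℝ E = 3) (hL : finrank ℝ L = 2)
    (hM : finrank ℝ M = 2) (hLE : L ≤ E) (hME : M ≤ E) : ∃ y ∈ L ⊓ M, y ≠ 0 := by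
  apply Submodule.exists_mem_ne_zero_of_ne_bot
  intro h
  have h1 := Submodule.finrank_sup_add_finrank_inf_eq L M
  have h2 := Submodule.finrank_mono (sup_le hLE hME)
  rw [h, finrank_bot] at h1
  omega

/-- If `Z` lies on the line `XY` and `Z ≠ X`, then `Y` lies on the line `XZ`. -/
theorem le_line_exchange {X Y Z : RP n} (h : Z.submodule ≤ line X Y) (hne : Z ≠ X) :
    Y.submodule ≤ line X Z := by
  have h1 : line X Z ≤ line X Y := sup_le (left_le_line X Y) h
  have h2 : line X Z = line X Y := by
    refine Submodule.eq_of_le_of_finrank_le h1 ?_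
    rw [finrank_line_of_ne hne.symm]
    exact finrank_line_le X Y
  rw [h2]
  exact right_le_line X Y

/-! ### Touching lines -/

section Touch

variable {φ : LinearMap.BilinForm ℝ (Fin (n + 1) → ℝ)} {E L : Space n} {X : RP n}

theorem TouchesAt.mem {C : Set (RP n)} (h : TouchesAt C L X) : X ∈ C :=
  (show X ∈ C ∩ pts L from h.symm ▸ Set.mem_singleton X).1

theorem TouchesAt.le {C : Set (RP n)} (h : TouchesAt C L X) : X.submodule ≤ L :=
  (show X ∈ C ∩ pts L from h.symm ▸ Set.mem_singleton X).2

theorem TouchesAt.eq {C : Set (RP n)} (h : TouchesAt C L X) {Y : RP n} (hY : Y ∈ C)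
    (hL : Y.submodule ≤ L) : Y = X := by
  have : Y ∈ C ∩ pts L := ⟨hY, hL⟩
  rw [h] at this
  exact this

theorem TouchesAt.mem_submodule (h : TouchesAt (zeroSet φ ∩ pts E) L X) (hLE : L ≤ E)
    {z : Fin (n + 1) → ℝ} (hz : z ∈ L) (hφ : φ z z = 0) : z ∈ X.submodule := by
  by_cases h0 : z = 0
  · simp [h0]
  have hle : (Projectivization.mk ℝ z h0).submodule ≤ L := by
    rw [Projectivization.submodule_mk, Submodule.span_singleton_le_iff_mem]; exact hz
  rw [← h.eq ⟨mk_mem_zeroSet h0 hφ, hle.trans hLE⟩ hle, Projectivization.submodule_mk]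
  exact Submodule.mem_span_singleton_self z

/-- A line that touches a quadric in `X` is conjugate to `X`. -/
theorem TouchesAt.le_ker (hφ : φ.IsSymm) (h : TouchesAt (zeroSet φ ∩ pts E) L X) (hLE : L ≤ E) :
    L ≤ LinearMap.ker (φ X.rep) := by
  intro y hy
  rw [LinearMap.mem_ker]
  by_contra hne
  have hx : φ X.rep X.rep = 0 := h.mem.1
  have hs : φ y X.rep = φ X.rep y := hφ.eq y X.rep
  have hxL : X.rep ∈ L := submodule_le_iff_rep_mem.1 h.le
  -- This is the second isotropic vector on the line through `X.rep` and `y`. Touching makes it a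
  -- multiple of `X.rep`, and so `y` too, since the coefficient of `y` is nonzero.
  have hz : φ y y • X.rep - (2 * φ X.rep y) • y ∈ X.submodule := by
    apply h.mem_submodule hLE (L.sub_mem (L.smul_mem _ hxL) (L.smul_mem _ hy))
    simp only [map_sub, map_smul, LinearMap.sub_apply, LinearMap.smul_apply, smul_eq_mul, hx, hs]
    ring
  have hy' : y ∈ X.submodule := by
    rw [Submodule.sub_mem_iff_right _ (Submodule.smul_mem _ _ (rep_mem_submodule X)),
      Submodule.smul_mem_iff _ (mul_ne_zero two_ne_zero hne)] at hz
    exact hz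
  rw [Projectivization.submodule_eq, Submodule.mem_span_singleton] at hy'
  obtain ⟨r, rfl⟩ := hy'
  simp [hx] at hne

end Touch

/-! ### Inscribed conics do not pass through the vertices -/

/-- A conic that touches the edge lines `UV`, `VW`, `UZ` of a planar quad `UVWZ`, and that passes
through the intersection of `UV` and `WZ` if it is a double line, does not touch `UV` in `V`. -/
theorem not_touchesAt_vertex {φ : LinearMap.BilinForm ℝ (Fin (n + 1) → ℝ)} {E : Space n}
    {U V W Z : RP n} (hφ : φ.IsSymm) (hE : finrank ℝ E = 3)
    (hU : U.submodule ≤ E) (hV : V.submodule ≤ E) (hW : W.submodule ≤ E) (hZ : Z.submodule ≤ E)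
    (hUVW : finrank ℝ (plane U V W) = 3) (hUZV : finrank ℝ (plane U Z V) = 3)
    (hWZV : finrank ℝ (plane W Z V) = 3)
    (hVW : ∃ X, TouchesAt (zeroSet φ ∩ pts E) (line V W) X)
    (hUZ : ∃ X, TouchesAt (zeroSet φ ∩ pts E) (line U Z) X)
    (hdouble : ∀ ℓ : Space n, finrank ℝ ℓ = 2 → zeroSet φ ∩ pts E = pts ℓ →
      line U V ⊓ line W Z ≤ ℓ) :
    ¬ TouchesAt (zeroSet φ ∩ pts E) (line U V) V := by
  intro hUV
  have hUVE : line U V ≤ E := sup_le hU hV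
  -- `V` is on the conic and on `VW`, so `VW` also touches at `V`. Both lines are conjugate to `V`
  -- and they span `E`: the conic is singular at `V`.
  have hVE : E ≤ LinearMap.ker (φ V.rep) := by
    obtain ⟨X, hX⟩ := hVW
    obtain rfl := hX.eq hUV.mem (left_le_line V W)
    rw [← plane_eq_of_le hE hUVW hU hV hW]
    exact sup_le (hUV.le_ker hφ hUVE)
      ((right_le_line V W).trans (hX.le_ker hφ (sup_le hV hW)))
  obtain ⟨X, hX⟩ := hUZ
  have hUZE : line U Z ≤ E := sup_le hU hZ
  -- `X` is conjugate to `UZ` by touching and to `V` because `V` is singular, so `X` is singular as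
  -- well.
  have hXE : E ≤ LinearMap.ker (φ X.rep) := by
    rw [← plane_eq_of_le hE hUZV hU hZ hV]
    refine sup_le (hX.le_ker hφ hUZE) (submodule_le_iff_rep_mem.2 ?_)
    rw [LinearMap.mem_ker, ← hφ.eq]
    exact hVE (submodule_le_iff_rep_mem.1 (hX.le.trans hUZE))
  have hXV : finrank ℝ (line X V) = 2 := by
    apply finrank_line_of_ne
    rintro rfl
    exact not_le_line_of_finrank_plane hUZV hX.le
  have hXVE : line X V ≤ E := sup_le (hX.le.trans hUZE) hV
  have hker : ∀ y ∈ E, line X V ≤ LinearMap.ker (φ y) := fun y hy =>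
    sup_le (submodule_le_iff_rep_mem.2 ((hφ.eq _ _).symm.trans (hXE hy)))
      (submodule_le_iff_rep_mem.2 ((hφ.eq _ _).symm.trans (hVE hy)))
  have hiso : ∀ y ∈ line X V, φ y y = 0 := fun y hy => hker y (hXVE hy) hy
  -- A conic point off the singular line `XV` would make the form vanish on all of `E`. Then `U`
  -- would be on the conic, whereas `UV` meets it only in `V`.
  have hC : zeroSet φ ∩ pts E = pts (line X V) := by
    apply Set.Subset.antisymm
    · rintro Y ⟨hY, hYE⟩
      by_contra hYXV
      have hplane := plane_eq_of_le hE (finrank_plane_of_not_le hXV hYXV)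
        (hX.le.trans hUZE) hV hYE
      have hYker : E ≤ LinearMap.ker (φ Y.rep) := by
        conv_lhs => rw [← hplane]
        exact sup_le (hker _ (submodule_le_iff_rep_mem.1 hYE)) (submodule_le_iff_rep_mem.2 hY)
      have hUrep : U.rep ∈ E := submodule_le_iff_rep_mem.1 hU
      have hUker : E ≤ LinearMap.ker (φ U.rep) := by
        conv_lhs => rw [← hplane]
        exact sup_le (hker _ hUrep)
          (submodule_le_iff_rep_mem.2 ((hφ.eq _ _).symm.trans (hYker hUrep)))
      have hUV' : U.rep ∈ V.submodule := hUV.mem_submodule hUVE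
        (submodule_le_iff_rep_mem.1 (left_le_line U V)) (hUker hUrep)
      obtain rfl := eq_of_submodule_le (submodule_le_iff_rep_mem.2 hUV')
      exact not_le_line_of_finrank_plane hUZV (left_le_line _ _)
    · intro Y hY
      exact ⟨hiso _ (submodule_le_iff_rep_mem.1 hY), le_trans hY hXVE⟩
  -- The point `UV ∩ WZ` lies on the double line, so it is a conic point of `UV`, that is, `V`. But
  -- `V` is not on `WZ`.
  obtain ⟨y, hy, hy0⟩ := exists_ne_zero_mem_inf hE (finrank_line_of_finrank_plane hUVW)
    (finrank_line_of_finrank_plane hWZV) hUVE (sup_le hW hZ)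
  have hyV : y ∈ V.submodule := hUV.mem_submodule hUVE hy.1 (hiso y (hdouble _ hXV hC hy))
  exact not_le_line_of_finrank_plane hWZV ((submodule_le_iff_mem hyV hy0).2 hy.2)

/-- Each edge with a chosen endpoint gives a relabelling `UVWZ` of the quad, eight in all. The
Laplace point needed is the one on the edge considered: `hd2` for south and north, `hd1` for west
and east. -/
theorem IsInscribedConic.touching_point_ne_vertex {A B D F : RP n} {C : Set (RP n)}
    (h : IsInscribedConic A B D F C) {E : Space n} (hE : finrank ℝ E = 3)
    (hA : A.submodule ≤ E) (hB : B.submodule ≤ E) (hD : D.submodule ≤ E) (hF : F.submodule ≤ E)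
    (hABD : finrank ℝ (plane A B D) = 3) (hABF : finrank ℝ (plane A B F) = 3)
    (hADF : finrank ℝ (plane A D F) = 3) (hBDF : finrank ℝ (plane B D F) = 3) :
    (∀ X, TouchesAt C (line A B) X → X ≠ A ∧ X ≠ B) ∧
    (∀ X, TouchesAt C (line D F) X → X ≠ D ∧ X ≠ F) ∧
    (∀ X, TouchesAt C (line A D) X → X ≠ A ∧ X ≠ D) ∧
    (∀ X, TouchesAt C (line B F) X → X ≠ B ∧ X ≠ F) := by
  obtain ⟨⟨φ, hφ, -, rfl⟩, hs, hn, hw, he, hd⟩ := h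
  rw [plane_eq_of_le hE hABD hA hB hD] at hs hn hw he hd ⊢
  have hd1 : ∀ ℓ : Space n, finrank ℝ ℓ = 2 → zeroSet φ ∩ pts E = pts ℓ →
      line A D ⊓ line B F ≤ ℓ := fun ℓ h1 h2 => (hd ℓ h1 h2).symm ▸ le_sup_left
  have hd2 : ∀ ℓ : Space n, finrank ℝ ℓ = 2 → zeroSet φ ∩ pts E = pts ℓ →
      line A B ⊓ line D F ≤ ℓ := fun ℓ h1 h2 => (hd ℓ h1 h2).symm ▸ le_sup_right
  have key := fun {U V W Z : RP n} => @not_touchesAt_vertex n φ E U V W Z hφ hE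
  have perm : ∀ {X Y Z : RP n}, finrank ℝ (plane X Y Z) = 3 →
      finrank ℝ (plane Y Z X) = 3 ∧ finrank ℝ (plane Z X Y) = 3 ∧ finrank ℝ (plane Y X Z) = 3 ∧
      finrank ℝ (plane X Z Y) = 3 ∧ finrank ℝ (plane Z Y X) = 3 := by
    intro X Y Z h
    have h1 : finrank ℝ (plane Y Z X) = 3 := by rwa [← plane_rotate]
    have h2 : finrank ℝ (plane Z X Y) = 3 := by rwa [← plane_rotate]
    exact ⟨h1, h2, by rwa [plane_swap], by rwa [plane_swap], by rwa [plane_swap]⟩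
  obtain ⟨a1, a2, a3, a4, a5⟩ := perm hABD
  obtain ⟨b1, b2, b3, b4, b5⟩ := perm hABF
  obtain ⟨c1, c2, c3, c4, c5⟩ := perm hADF
  obtain ⟨d1, d2, d3, d4, d5⟩ := perm hBDF
  refine ⟨fun X hX => ⟨?_, ?_⟩, fun X hX => ⟨?_, ?_⟩, fun X hX => ⟨?_, ?_⟩,
    fun X hX => ⟨?_, ?_⟩⟩ <;> intro h <;> rw [h] at hX
  · refine key hB hA hD hF a3 b1 c1
      (by simpa only [line_comm] using hw) (by simpa only [line_comm] using he)
      (by simpa only [line_comm, inf_comm] using hd2) (by simpa only [line_comm] using hX)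
  · refine key hA hB hF hD hABF a4 d5
      (by simpa only [line_comm] using he) (by simpa only [line_comm] using hw)
      (by simpa only [line_comm, inf_comm] using hd2) (by simpa only [line_comm] using hX)
  · refine key hF hD hA hB c5 d2 hABD
      (by simpa only [line_comm] using hw) (by simpa only [line_comm] using he)
      (by simpa only [line_comm, inf_comm] using hd2) (by simpa only [line_comm] using hX)
  · refine key hD hF hB hA d1 c3 b3
      (by simpa only [line_comm] using he) (by simpa only [line_comm] using hw)
      (by simpa only [line_comm, inf_comm] using hd2) (by simpa only [line_comm] using hX)
  · refine key hD hA hB hF a2 c1 b1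
      (by simpa only [line_comm] using hs) (by simpa only [line_comm] using hn)
      (by simpa only [line_comm, inf_comm] using hd1) (by simpa only [line_comm] using hX)
  · refine key hA hD hF hB hADF hABD d2
      (by simpa only [line_comm] using hn) (by simpa only [line_comm] using hs)
      (by simpa only [line_comm, inf_comm] using hd1) (by simpa only [line_comm] using hX)
  · refine key hF hB hA hD b5 d5 a4
      (by simpa only [line_comm] using hs) (by simpa only [line_comm] using hn)
      (by simpa only [line_comm, inf_comm] using hd1) (by simpa only [line_comm] using hX)
  · refine key hB hF hD hA d4 b3 c3
      (by simpa only [line_comm] using hn) (by simpa only [line_comm] using hs)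
      (by simpa only [line_comm, inf_comm] using hd1) (by simpa only [line_comm] using hX)

/-! ### Tangency along a chain of touching points -/

theorem conjugate_of_touching_chain {φ : LinearMap.BilinForm ℝ (Fin (n + 1) → ℝ)} {m : ℕ}
    (hφ : φ.IsSymm) (p : Fin (m + 1) → RP n) (t : Fin m → RP n)
    (hiso : pts (⨆ j, (t j).submodule) ⊆ zeroSet φ)
    (hle : ∀ j, (t j).submodule ≤ line (p j.castSucc) (p j.succ))
    (hpolar : ∀ j, line (p j.castSucc) (p j.succ) ≤ LinearMap.ker (φ (t j).rep))
    (hne : ∀ j, t j ≠ p j.castSucc ∧ t j ≠ p j.succ) :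
    ∀ x ∈ ⨆ j, (p j).submodule, ∀ y ∈ ⨆ j, (t j).submodule, φ x y = 0 := by
  set N : Space n := ⨆ j, (t j).submodule with hN
  have htN : ∀ j, (t j).submodule ≤ N := fun j => le_iSup (fun j => (t j).submodule) j
  have hNiso : ∀ v ∈ N, φ v v = 0 := by
    intro v hv
    by_cases h0 : v = 0
    · simp [h0]
    have hmem : Projectivization.mk ℝ v h0 ∈ pts N := by
      change (Projectivization.mk ℝ v h0).submodule ≤ N
      rw [Projectivization.submodule_mk, Submodule.span_singleton_le_iff_mem]; exact hv
    refine mem_zeroSet_iff.1 (hiso hmem) v ?_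
    rw [Projectivization.submodule_mk]
    exact Submodule.mem_span_singleton_self v
  have hNN : ∀ v ∈ N, ∀ w ∈ N, φ v w = 0 := by
    intro v hv w hw
    have h := hNiso (v + w) (N.add_mem hv hw)
    have hs : φ w v = φ v w := hφ.eq w v
    simp only [map_add, LinearMap.add_apply, hNiso v hv, hNiso w hw, hs] at h
    linarith
  have htker : ∀ j k, (t k).submodule ≤ LinearMap.ker (φ (t j).rep) := fun j k v hv =>
    hNN _ (htN j (rep_mem_submodule _)) _ (htN k hv)
  have hstep : ∀ j k, (p (Fin.castSucc k)).submodule ≤ LinearMap.ker (φ (t j).rep) ↔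
      (p (Fin.succ k)).submodule ≤ LinearMap.ker (φ (t j).rep) := by
    intro j k
    constructor
    · intro h
      exact (le_line_exchange (hle k) (hne k).1).trans (sup_le h (htker j k))
    · intro h
      exact (le_line_exchange ((hle k).trans_eq (line_comm _ _)) (hne k).2).trans
        (sup_le h (htker j k))
  have hall : ∀ j k, (p k).submodule ≤ LinearMap.ker (φ (t j).rep) := by
    intro j k
    have h0 : ∀ k, (p k).submodule ≤ LinearMap.ker (φ (t j).rep) ↔
        (p 0).submodule ≤ LinearMap.ker (φ (t j).rep) := by
      intro k
      induction k using Fin.induction with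
      | zero => rfl
      | succ k ih => rw [← hstep, ih]
    -- Since `hstep` is an equivalence, vertex 0 links the known vertex `j.castSucc` to every `k`,
    -- on either side of it.
    exact (h0 k).2 ((h0 j.castSucc).1 ((left_le_line _ _).trans (hpolar j)))
  intro x hx y hy
  have hxker : N ≤ LinearMap.ker (φ x) := by
    refine iSup_le fun j => submodule_le_iff_rep_mem.2 ?_
    rw [LinearMap.mem_ker, ← hφ.eq]
    exact (iSup_le (hall j) : (⨆ k, (p k).submodule) ≤ _) hx
  exact hxker hy

theorem isTangentAlong_of_touching_chain {Q : Set (RP n)} (hQ : IsQuadric Q) {m : ℕ}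
    (p : Fin (m + 1) → RP n) (t : Fin m → RP n) (hiso : pts (⨆ j, (t j).submodule) ⊆ Q)
    (htouch : ∀ j, ∃ E : Space n, line (p j.castSucc) (p j.succ) ≤ E ∧
      TouchesAt (Q ∩ pts E) (line (p j.castSucc) (p j.succ)) (t j))
    (hne : ∀ j, t j ≠ p j.castSucc ∧ t j ≠ p j.succ) :
    IsTangentAlong Q (⨆ j, (p j).submodule) (⨆ j, (t j).submodule) := by
  have hle : ∀ j, (t j).submodule ≤ line (p j.castSucc) (p j.succ) := fun j =>
    (htouch j).choose_spec.2.le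
  refine ⟨hQ, ?_, hiso, ?_⟩
  · refine iSup_le fun j => (hle j).trans (sup_le ?_ ?_)
    · exact le_iSup (fun k => (p k).submodule) j.castSucc
    · exact le_iSup (fun k => (p k).submodule) j.succ
  · rintro φ ⟨hφ, -, rfl⟩
    refine conjugate_of_touching_chain hφ p t hiso hle (fun j => ?_) hne
    obtain ⟨E, hE, hT⟩ := htouch j
    exact hT.le_ker hφ hE

/-! ### ### Columns and rows of a net -/

/-- One adjacent face per edge suffices, because both neighbours share the touching point. On a
boundary line only one side is available. -/
theorem exists_adjacent {m : ℕ} (hm : 1 ≤ m) (i : Fin (m + 1)) :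
    ∃ k : Fin m, k.castSucc = i ∨ k.succ = i := by
  induction i using Fin.cases with
  | zero => exact ⟨⟨0, hm⟩, Or.inl rfl⟩
  | succ k => exact ⟨k, Or.inr rfl⟩

theorem TouchingConics.touching_point_ne_vertex {a b : ℕ} {P : Net n a b}
    (hP : IsNondegenerate P) (c : TouchingConics P) (i : Fin a) (j : Fin b) :
    (∀ X, TouchesAt (c.conic i j) (line (P i.castSucc j.castSucc) (P i.succ j.castSucc)) X →
      X ≠ P i.castSucc j.castSucc ∧ X ≠ P i.succ j.castSucc) ∧
    (∀ X, TouchesAt (c.conic i j) (line (P i.castSucc j.succ) (P i.succ j.succ)) X →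
      X ≠ P i.castSucc j.succ ∧ X ≠ P i.succ j.succ) ∧
    (∀ X, TouchesAt (c.conic i j) (line (P i.castSucc j.castSucc) (P i.castSucc j.succ)) X →
      X ≠ P i.castSucc j.castSucc ∧ X ≠ P i.castSucc j.succ) ∧
    (∀ X, TouchesAt (c.conic i j) (line (P i.succ j.castSucc) (P i.succ j.succ)) X →
      X ≠ P i.succ j.castSucc ∧ X ≠ P i.succ j.succ) := by
  obtain ⟨E, hE, h1, h2, h3, h4⟩ := hP.qnet i j
  obtain ⟨f1, f2, f3, f4⟩ := hP.face i j
  exact (c.inscribed i j).touching_point_ne_vertex hE h1 h2 h3 h4 f1 f2 f3 f4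

theorem succ_succ_le_plane_of_face {a b : ℕ} {P : Net n a b} (hP : IsNondegenerate P)
    (i : Fin a) (j : Fin b) :
    (P i.succ j.succ).submodule ≤ plane (P i.castSucc j.castSucc) (P i.succ j.castSucc)
      (P i.castSucc j.succ) := by
  obtain ⟨E, hE, h1, h2, h3, h4⟩ := hP.qnet i j
  rw [plane_eq_of_le hE (hP.face i j).1 h1 h2 h3]
  exact h4

theorem IsInscribedQuadric.isTangentAlong_vertical {a b : ℕ} {P : Net n a b} (ha : 1 ≤ a)
    (hP : IsNondegenerate P) {c : TouchingConics P} {Q : Set (RP n)}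
    (hQ : IsInscribedQuadric c Q) (i : Fin (a + 1)) :
    IsTangentAlong Q (verticalSpace P i) (c.spaceT i) := by
  obtain ⟨k, hk⟩ := exists_adjacent ha i
  refine isTangentAlong_of_touching_chain hQ.quadric (P i) (c.T i) (hQ.spaceT_subset i)
    (fun j => ?_) (fun j => ?_)
  -- The plane is that of the face `(k, j)`. It is spanned by three vertices, so a west edge lies in
  -- it at once, while an east edge needs planarity for the fourth vertex.
  · refine ⟨_, ?_, hQ.conic_eq k j ▸ c.touchesAt_T i j k hk⟩
    obtain rfl | rfl := hk
    · exact sup_le (le_sup_left.trans le_sup_left) le_sup_right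
    · exact sup_le (le_sup_right.trans le_sup_left) (succ_succ_le_plane_of_face hP k j)
  · have ht := c.touchesAt_T i j k hk
    obtain ⟨-, -, hw, he⟩ := c.touching_point_ne_vertex hP k j
    obtain rfl | rfl := hk
    · exact hw _ ht
    · exact he _ ht

theorem IsInscribedQuadric.isTangentAlong_horizontal {a b : ℕ} {P : Net n a b} (hb : 1 ≤ b)
    (hP : IsNondegenerate P) {c : TouchingConics P} {Q : Set (RP n)}
    (hQ : IsInscribedQuadric c Q) (j : Fin (b + 1)) :
    IsTangentAlong Q (horizontalSpace P j) (c.spaceS j) := by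
  obtain ⟨k, hk⟩ := exists_adjacent hb j
  refine isTangentAlong_of_touching_chain hQ.quadric (fun i => P i j) (fun i => c.S i j)
    (hQ.spaceS_subset j) (fun i => ?_) (fun i => ?_)
  · refine ⟨_, ?_, hQ.conic_eq i k ▸ c.touchesAt_S i j k hk⟩
    obtain rfl | rfl := hk
    · exact le_sup_left
    · exact sup_le le_sup_right (succ_succ_le_plane_of_face hP i k)
  · have ht := c.touchesAt_S i j k hk
    obtain ⟨hs, hn, -, -⟩ := c.touching_point_ne_vertex hP i k
    obtain rfl | rfl := hk
    · exact hs _ ht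
    · exact hn _ ht

end Koenigs

theorem mainTheorem2 (a b : ℕ) (ha : 1 ≤ a) (hb : 1 ≤ b) (P : Koenigs.Net (a + b) a b)
    (hK : Koenigs.IsKoenigsNet P) (hE : Koenigs.IsExtensive P)
    (c : Koenigs.TouchingConics P) (Q : Set (Koenigs.RP (a + b)))
    (hQ : Koenigs.IsInscribedQuadric c Q) :
    (∀ i : Fin (a + 1), Koenigs.IsTangentAlong Q (Koenigs.verticalSpace P i) (c.spaceT i)) ∧
    (∀ j : Fin (b + 1), Koenigs.IsTangentAlong Q (Koenigs.horizontalSpace P j) (c.spaceS j)) := by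
  exact ⟨fun i => hQ.isTangentAlong_vertical ha hE.1 i,
    fun j => hQ.isTangentAlong_horizontal hb hE.1 j⟩
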